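/- **Setting.** A CSS code on $n$ data qubits is given by parity-check matrices $H_X,H_Z$ over $\mathbb F_2$ with $H_XH_Z^{\mathsf T}=0$; their rows are the $X$- and $Z$-checks. Let $L_X$ (resp. $L_Z$) be a matrix whose rows represent a basis of $\ker H_Z$ modulo $\operatorname{span}(H_X)$ (resp. of $\ker H_X$ modulo $\operatorname{span}(H_Z)$), where $\operatorname{span}$ denotes the row span. *Circuits.* A single-ancilla, CNOT-based syndrome extraction circuit (SEC) $\mathcal C$ assigns to each check a dedicated ancilla and the time steps of its preparation, of one CNOT with each data qubit in the support of the check, and of its measurement. The ancilla of an $X$ ($Z$) check is prepared in $|+\rangle$ ($|0\rangle$), is the control (target) of its CNOTs and is measured in the $X$ ($Z$) basis; a qubit takes part in at most one operation at a time, and the noiseless circuit measures all checks. The circuit is repeated for several rounds, each being a time shift of the same circuit; rounds may be staggered, but an ancilla is measured before it is prepared again. $\mathcal C$ is *non-interleaved* if, in each round, either all CNOTs of $X$-checks precede all CNOTs of $Z$-checks on the same data qubit, or all CNOTs of $Z$-checks precede all CNOTs of $X$-checks on the same data qubit. *Circuit distance.* In the $M$-round $B$-basis memory experiment ($B\in\{X,Z\}$,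 $M\ge1$), data qubits are prepared in the basis $B$, $M$ rounds are performed, and the data qubits are measured in the basis $B$. The error mechanisms are: a preparation of a data or ancilla qubit yields the orthogonal state; a measurement outcome of a data or ancilla qubit is flipped; a CNOT is followed by a non-identity two-qubit Pauli operator; an idle operation is followed by a non-identity Pauli operator. The detectors compare the outcomes of a check in consecutive rounds and, for the checks of type $B$, also compare the first outcome with its value in the prepared state and the last outcome with its value reconstructed from the final data measurements; the logical observables are the rows of $L_B$. The circuit distance $d_{\mathrm{circ}}$ of $\mathcal C$ is the minimum over both bases $B$ of the minimum number of error mechanisms that together flip no detector but at least one logical observable. *Residual errors.* For a check with support $i_1,\dots,i_w$ listed in CNOT order, the residual errors are $E_l=\sum_{s=l}^{w}e_{i_s}\in\mathbb F_2^n$, $l=2,\dots,w$; they are of the type ($X$ or $Z$) of the check. Let $\mathcal E=\mathcal E_X\sqcup\mathcal E_Z$ be the disjoint union of the sets of residual errors of all $X$- and all $Z$-checks. For a $Z$-type residual error $E$, the residual distance is $$\Delta(E)=1+\min\{|D| : D\in\mathbb F_2^n,\ E+D\in\ker H_X\setminus\operatorname{span}(H_Z)\},$$ where $|\cdot|$ is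 the Hamming weight. For $\mathcal R_Z\subseteq\mathcal E_Z$, append to each of $H_X$ and $L_X$, for every $E\in\mathcal R_Z$, the column that is the sum of its columns in the support of $E$; $d^Z_{\mathrm{ext}}(\mathcal R_Z)$ is the minimum Hamming weight of a vector $x$ with $H_X^{\mathrm{ext}}x=0$ and $L_X^{\mathrm{ext}}x\ne0$. The $X$-type notions are obtained by exchanging $X$ and $Z$, and $d_{\mathrm{ext}}(\mathcal R_X\sqcup\mathcal R_Z)=\min\bigl(d^X_{\mathrm{ext}}(\mathcal R_X),d^Z_{\mathrm{ext}}(\mathcal R_Z)\bigr)$. Minima over empty sets are $\infty$. **Theorem (Circuit distance bounds).** Let $\mathcal C$ be any single-ancilla, CNOT-based SEC for a CSS code, and let $\mathcal C'$ be a non-interleaved SEC for the same code that has the same relative CNOT order within each check. Then $\mathcal C$ and $\mathcal C'$ have the same set $\mathcal E$ of residual errors, and their circuit distances $d_{\mathrm{circ}}$ and $d'_{\mathrm{circ}}$, for any numbers $M,M'\ge1$ of rounds respectively, satisfy $$d'_{\mathrm{circ}}\le\Delta(E)\quad\forall E\in\mathcal E,\qquad d'_{\mathrm{circ}}\le d_{\mathrm{ext}}(\mathcal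 R)\quad\forall\mathcal R\subseteq\mathcal E,\qquad d'_{\mathrm{circ}}=d_{\mathrm{ext}}(\mathcal E),\qquad d'_{\mathrm{circ}}\le d_{\mathrm{circ}}.$$ -/

import Mathlib

/-! Syndrome extraction circuits for CSS codes, circuit-level noise, residual errors and the
associated distances. All distances take values in `ℕ∞`, and the minimum over an empty set is `⊤`. -/

namespace CSSCircuit

/-- The two CSS types: types of checks, of Pauli components, and of single-qubit bases. -/
inductive PauliType where
  | X : PauliType
  | Z : PauliType
  deriving DecidableEq

instance : Fintype PauliType where
  elems := {.X, .Z}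
  complete := by intro b; cases b <;> simp

/-- Exchange of `X` and `Z`. -/
def PauliType.swap : PauliType → PauliType
  | .X => .Z
  | .Z => .X

/-- A CSS code on `n` data qubits, given by parity-check matrices `H X`, `H Z` over `𝔽₂`
(whose rows are the chosen checks) with `H_X H_Zᵀ = 0`. -/
structure CSSCode (n : ℕ) where
  /-- number of checks of each type -/
  m : PauliType → ℕ
  /-- parity-check matrices -/
  H : (b : PauliType) → Matrix (Fin (m b)) (Fin n) (ZMod 2)
  comm : H .X * (H .Z).transpose = 0

variable {n : ℕ}

namespace CSSCode

/-- The `b`-type stabilisers: the row span of `H_b`. -/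
def stab (K : CSSCode n) (b : PauliType) : Submodule (ZMod 2) (Fin n → ZMod 2) :=
  Submodule.span (ZMod 2) (Set.range (K.H b))

/-- The `b`-type operators commuting with all checks of the other type: `ker H_{b.swap}`. -/
def normalizer (K : CSSCode n) (b : PauliType) : Submodule (ZMod 2) (Fin n → ZMod 2) :=
  LinearMap.ker (K.H b.swap).mulVecLin

/-- A check: its type together with a row index of the corresponding matrix. -/
abbrev Check (K : CSSCode n) : Type := Σ b : PauliType, Fin (K.m b)

/-- The data qubits in the support of a check. -/
def supp (K : CSSCode n) (c : K.Check) : Finset (Fin n) :=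
  Finset.univ.filter fun q => K.H c.1 c.2 q = 1

/-- The qubits: data qubits, and one dedicated ancilla for each check. -/
abbrev Qubit (K : CSSCode n) : Type := Fin n ⊕ K.Check

end CSSCode

/-- Logical operator matrices `L X`, `L Z`: for each type `b`, the rows of `L b` represent a basis
of the `b`-type logical operators `ker H_{b.swap}` modulo the `b`-type stabilisers. -/
structure LogicalBasis (K : CSSCode n) where
  /-- number of logical qubits -/
  k : ℕ
  /-- logical operator matrices -/
  L : PauliType → Matrix (Fin k) (Fin n) (ZMod 2)
  span_eq : ∀ b, K.stab b ⊔ Submodule.span (ZMod 2) (Set.range (L b)) = K.normalizer b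
  indep : ∀ b, LinearIndependent (ZMod 2) fun i : Fin k => (K.stab b).mkQ (L b i)

/-- A single-ancilla, CNOT-based syndrome extraction circuit. It is specified by the time steps, for
each check, of the ancilla preparation, of the CNOTs with the data qubits in its support, and of the
ancilla measurement. The circuit is repeated for rounds `0, 1, 2, …`; the operations of
round `r` are shifted by `start r`, and successive rounds may be staggered (may overlap in time).

The ancilla of an `X` (`Z`) check is prepared in `|+⟩` (`|0⟩`), is the control (target) of its CNOTs
and is measured in the `X` (`Z`) basis. -/
structure SEC (K : CSSCode n) where
  /-- time step of the ancilla preparation -/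
  prep : K.Check → ℕ
  /-- time step of the CNOT between the ancilla and a data qubit in the support of the check -/
  cnot : K.Check → Fin n → ℕ
  /-- time step of the ancilla measurement -/
  meas : K.Check → ℕ
  /-- time shift of each round -/
  start : ℕ → ℕ
  prep_lt_meas : ∀ c, prep c < meas c
  prep_lt_cnot : ∀ c, ∀ q ∈ K.supp c, prep c < cnot c q
  cnot_lt_meas : ∀ c, ∀ q ∈ K.supp c, cnot c q < meas c
  /-- the ancilla is measured before it is prepared again in the next round -/
  reuse : ∀ r c, start r + meas c < start (r + 1) + prep c
  /-- an ancilla participates in at most one CNOT at a time -/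
  cnot_inj : ∀ c, Set.InjOn (cnot c) (K.supp c)
  /-- a data qubit participates in at most one CNOT at a time -/
  no_clash : ∀ r s c c' q, q ∈ K.supp c → q ∈ K.supp c' →
    start r + cnot c q = start s + cnot c' q → c = c'
  /-- The noiseless circuit measures the checks. Pulling the operator measured on an `X` ancilla back
  through the circuit gives the `X` check on the data qubits, times an `X` on every `Z` ancilla whose
  CNOTs precede those of the `X` check on an odd number of the shared data qubits; there must be no
  such `Z` ancilla, as it is prepared in `|0⟩`. The condition for measurements of `Z` ancillas is
  the same one, since the supports of an `X` and a `Z` check share an even number of qubits. -/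
  valid : ∀ (r s : ℕ) (x : Fin (K.m .X)) (z : Fin (K.m .Z)),
    Even ((K.supp ⟨.X, x⟩ ∩ K.supp ⟨.Z, z⟩).filter fun q =>
      start s + cnot ⟨.Z, z⟩ q < start r + cnot ⟨.X, x⟩ q).card

/-- A single-qubit Pauli operator up to phase, by its `X` and `Z` components (`Y` has both). -/
abbrev Pauli : Type := PauliType → ZMod 2

/-- A Pauli operator on all the qubits, up to phase. -/
abbrev Frame (K : CSSCode n) : Type := K.Qubit → Pauli

/-- Error mechanisms of circuit noise. In `cnot r c q P Q` the Pauli `P` acts on the ancilla and `Q`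
on the data qubit. -/
inductive Fault (K : CSSCode n) where
  /-- the preparation of a data qubit yields the orthogonal state -/
  | prepData (q : Fin n) : Fault K
  /-- the final measurement of a data qubit has its outcome flipped -/
  | measData (q : Fin n) : Fault K
  /-- the preparation of an ancilla in round `r` yields the orthogonal state -/
  | prepAnc (r : ℕ) (c : K.Check) : Fault K
  /-- the measurement of an ancilla in round `r` has its outcome flipped -/
  | measAnc (r : ℕ) (c : K.Check) : Fault K
  /-- the CNOT of the check `c` with the data qubit `q` in round `r` is followed by `P ⊗ Q` -/
  | cnot (r : ℕ) (c : K.Check) (q : Fin n) (P Q : Pauli) : Fault K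
  /-- the idle operation on the qubit `v` at time `t` is followed by `P` -/
  | idle (t : ℕ) (v : K.Qubit) (P : Pauli) : Fault K

namespace SEC

variable {K : CSSCode n}

/-- In `M` rounds, the CNOT between the ancilla of `c` and the data qubit `q` is applied at `t`. -/
def CNOTAt (C : SEC K) (M t : ℕ) (c : K.Check) (q : Fin n) : Prop :=
  q ∈ K.supp c ∧ ∃ r ∈ Finset.range M, t = C.start r + C.cnot c q

/-- In `M` rounds, the ancilla of `c` is prepared at time `t`. -/
def PrepAt (C : SEC K) (M t : ℕ) (c : K.Check) : Prop :=
  ∃ r ∈ Finset.range M, t = C.start r + C.prep c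

/-- In `M` rounds, the ancilla of `c` is measured at time `t`. -/
def MeasAt (C : SEC K) (M t : ℕ) (c : K.Check) : Prop :=
  ∃ r ∈ Finset.range M, t = C.start r + C.meas c

instance (C : SEC K) (M t : ℕ) (c : K.Check) (q : Fin n) : Decidable (C.CNOTAt M t c q) := by
  unfold CNOTAt; infer_instance

instance (C : SEC K) (M t : ℕ) (c : K.Check) : Decidable (C.PrepAt M t c) := by
  unfold PrepAt; infer_instance

instance (C : SEC K) (M t : ℕ) (c : K.Check) : Decidable (C.MeasAt M t c) := by
  unfold MeasAt; infer_instance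

/-- The qubit `v` idles at time `t`. -/
def IdleAt (C : SEC K) (M t : ℕ) : K.Qubit → Prop
  | .inl q => ∀ c, ¬ C.CNOTAt M t c q
  | .inr c => ¬ C.PrepAt M t c ∧ ¬ C.MeasAt M t c ∧ ∀ q, ¬ C.CNOTAt M t c q

/-- The number of time steps of `M` rounds. -/
def duration (C : SEC K) (M : ℕ) : ℕ :=
  (Finset.range M ×ˢ (Finset.univ : Finset K.Check)).sup fun p => C.start p.1 + C.meas p.2 + 1

/-- The error mechanisms that are present in the `M`-round memory experiment. -/
def IsFault (C : SEC K) (M : ℕ) : Fault K → Prop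
  | .prepData _ => True
  | .measData _ => True
  | .prepAnc r _ => r < M
  | .measAnc r _ => r < M
  | .cnot r c q P Q => r < M ∧ q ∈ K.supp c ∧ (P, Q) ≠ 0
  | .idle t v P => t < C.duration M ∧ C.IdleAt M t v ∧ P ≠ 0

/-- Propagation of a Pauli error through the operations of time step `t`. A CNOT adds the `X`
component of its control to its target, and the `Z` component of its target to its control. As the
ancilla is the control for `X` checks and the target for `Z` checks, the CNOTs of a check of type `b`
add the `b` component of the ancilla to the data qubit, and the other component of the data qubit to
the ancilla. A preparation resets the ancilla. (Each sum has at most one term, because a qubit is in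
at most one CNOT at a time.) -/
def propagate (C : SEC K) (M t : ℕ) (F : Frame K) : Frame K
  | .inl q => fun b => F (.inl q) b +
      ∑ c : K.Check, if C.CNOTAt M t c q ∧ c.1 = b then F (.inr c) b else 0
  | .inr c => if C.PrepAt M t c then 0 else fun b => F (.inr c) b +
      ∑ q : Fin n, if C.CNOTAt M t c q ∧ c.1 ≠ b then F (.inl q) b else 0

/-- The Pauli error that an error mechanism inserts right after the operations of time step `t`.
A preparation in the basis `b` is flipped by a Pauli operator of the other type. -/
def inject (C : SEC K) (t : ℕ) : Fault K → Frame K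
  | .prepAnc r c => if t = C.start r + C.prep c then
      Pi.single (.inr c) (Pi.single c.1.swap 1) else 0
  | .cnot r c q P Q => if t = C.start r + C.cnot c q then
      Pi.single (.inr c) P + Pi.single (.inl q) Q else 0
  | .idle s v P => if t = s then Pi.single v P else 0
  | _ => 0

/-- The Pauli error that an error mechanism inserts right after the data qubits have been prepared
in the basis `B`. -/
def injectInit (B : PauliType) : Fault K → Frame K
  | .prepData q => Pi.single (.inl q) (Pi.single B.swap 1)
  | _ => 0

/-- The Pauli error just before time step `t` in the `M`-round `B`-basis memory experiment with error
configuration `e`. The data qubits are prepared in the basis `B` before time step `0`. -/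
def frame (C : SEC K) (B : PauliType) (M : ℕ) (e : Finset (Fault K)) : ℕ → Frame K
  | 0 => ∑ f ∈ e, injectInit B f
  | t + 1 => C.propagate M t (C.frame B M e t) + ∑ f ∈ e, C.inject t f

/-- Whether (`1`) or not (`0`) a fault flips the classical outcome of ancilla `c` in round `r`. -/
def ancReadout (r : ℕ) (c : K.Check) : Fault K → ZMod 2
  | .measAnc r' c' => if r' = r ∧ c' = c then 1 else 0
  | _ => 0

/-- Whether (`1`) or not (`0`) a fault flips the classical outcome of the data qubit `q`. -/
def dataReadout (q : Fin n) : Fault K → ZMod 2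
  | .measData q' => if q' = q then 1 else 0
  | _ => 0

/-- The flip of the outcome of check `c` in round `r`: a measurement in the basis `b` is
flipped by the component of the other type. -/
def ancFlip (C : SEC K) (B : PauliType) (M : ℕ) (e : Finset (Fault K)) (r : ℕ) (c : K.Check) :
    ZMod 2 :=
  C.frame B M e (C.start r + C.meas c) (.inr c) c.1.swap + ∑ f ∈ e, ancReadout r c f

/-- The flips of the outcomes of the final measurement of the data qubits in the basis `B`. -/
def dataFlip (C : SEC K) (B : PauliType) (M : ℕ) (e : Finset (Fault K)) : Fin n → ZMod 2 :=
  fun q => C.frame B M e (C.duration M) (.inl q) B.swap + ∑ f ∈ e, dataReadout q f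

/-- The error configuration flips no detector of the `M`-round `B`-basis memory experiment. The
detectors compare the outcomes of a check in consecutive rounds; for checks of type `B`, moreover,
the first outcome is compared with its value in the prepared state, and the last outcome with the
value reconstructed from the final measurement of the data qubits. -/
def Undetected (C : SEC K) (B : PauliType) (M : ℕ) (e : Finset (Fault K)) : Prop :=
  (∀ c : K.Check, ∀ r, r + 1 < M → C.ancFlip B M e r c + C.ancFlip B M e (r + 1) c = 0) ∧
  (∀ i : Fin (K.m B), C.ancFlip B M e 0 ⟨B, i⟩ = 0) ∧
  (∀ i : Fin (K.m B),
    C.ancFlip B M e (M - 1) ⟨B, i⟩ + ((K.H B).mulVec (C.dataFlip B M e)) i = 0)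

/-- The minimum number of error mechanisms in the `M`-round (`M ≥ 1`) `B`-basis memory experiment
that flip no detector but flip at least one logical observable. -/
noncomputable def memoryDistance (C : SEC K) (L : LogicalBasis K) (B : PauliType) (M : ℕ) : ℕ∞ :=
  ⨅ e ∈ {e : Finset (Fault K) | (∀ f ∈ e, C.IsFault M f) ∧ C.Undetected B M e ∧
    (L.L B).mulVec (C.dataFlip B M e) ≠ 0}, (e.card : ℕ∞)

/-- The circuit distance, for `M`-round memory experiments. -/
noncomputable def circuitDistance (C : SEC K) (L : LogicalBasis K) (M : ℕ) : ℕ∞ :=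
  min (C.memoryDistance L .X M) (C.memoryDistance L .Z M)

/-- Within each round, all CNOTs of one type precede all CNOTs of the other type that
act on the same data qubit. -/
def NonInterleaved (C : SEC K) : Prop :=
  ∃ b : PauliType, ∀ (i : Fin (K.m b)) (j : Fin (K.m b.swap)),
    ∀ q ∈ K.supp ⟨b, i⟩ ∩ K.supp ⟨b.swap, j⟩, C.cnot ⟨b, i⟩ q < C.cnot ⟨b.swap, j⟩ q

/-- The two circuits have the same relative CNOT order within each check. -/
def SameOrder (C C' : SEC K) : Prop :=
  ∀ c, ∀ q ∈ K.supp c, ∀ q' ∈ K.supp c, C.cnot c q < C.cnot c q' ↔ C'.cnot c q < C'.cnot c q'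

/-- The vector `∑_{s ≥ l} e_{i_s}`, where `i_1, …, i_w` is the support of the check `c` in the CNOT
order and `q = i_l`. -/
def tail (C : SEC K) (c : K.Check) (q : Fin n) : Fin n → ZMod 2 :=
  fun q' => if q' ∈ K.supp c ∧ C.cnot c q ≤ C.cnot c q' then 1 else 0

/-- The complete set of residual errors `∑_{s ≥ l} e_{i_s}`, `2 ≤ l ≤ w`, of all checks, as a disjoint
union: each residual error is paired with its check. A residual error of a `b`-type check is
a `b`-type error. -/
def residualErrors (C : SEC K) : Finset (K.Check × (Fin n → ZMod 2)) :=
  ((Finset.univ : Finset (K.Check × Fin n)).filter fun p =>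
    p.2 ∈ K.supp p.1 ∧ ∃ q ∈ K.supp p.1, C.cnot p.1 q < C.cnot p.1 p.2).image
      fun p => (p.1, C.tail p.1 p.2)

end SEC

/-- The residual distance `Δ(E)`: one plus the minimum weight of a `D` such that `E + D` is a
non-trivial logical operator of the type `b` of `E`, i.e. lies in `ker H_{b.swap} ∖ span H_b`. -/
noncomputable def residualDistance (K : CSSCode n) (E : K.Check × (Fin n → ZMod 2)) : ℕ∞ :=
  1 + ⨅ D ∈ {D : Fin n → ZMod 2 | E.2 + D ∈ K.normalizer E.1.1 ∧ E.2 + D ∉ K.stab E.1.1},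
    (hammingNorm D : ℕ∞)

/-- Extension of a matrix by one column for each residual error in `R`: the sum of the columns of the
data qubits in that residual error. -/
def extend {K : CSSCode n} {a : ℕ} (A : Matrix (Fin a) (Fin n) (ZMod 2))
    (R : Finset (K.Check × (Fin n → ZMod 2))) : Matrix (Fin a) (Fin n ⊕ R) (ZMod 2) :=
  Matrix.fromCols A (Matrix.of fun i E => A.mulVec E.1.2 i)

/-- The `b`-type extended-code distance of a set of `b`-type residual errors: the minimum weight of
an `x` with `H^ext x = 0` and `L^ext x ≠ 0`, for the matrices `H`, `L` of the other type. -/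
noncomputable def typeExtDistance {K : CSSCode n} (L : LogicalBasis K) (b : PauliType)
    (R : Finset (K.Check × (Fin n → ZMod 2))) : ℕ∞ :=
  ⨅ x ∈ {x : Fin n ⊕ R → ZMod 2 |
    (extend (K.H b.swap) R).mulVec x = 0 ∧ (extend (L.L b.swap) R).mulVec x ≠ 0},
    (hammingNorm x : ℕ∞)

/-- The combined extended-code distance of a set of residual errors, which is split into its residual
errors of the two types. -/
noncomputable def extDistance {K : CSSCode n} (L : LogicalBasis K)
    (R : Finset (K.Check × (Fin n → ZMod 2))) : ℕ∞ :=
  min (typeExtDistance L .X (R.filter fun E => E.1.1 = .X))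
    (typeExtDistance L .Z (R.filter fun E => E.1.1 = .Z))

end CSSCircuit

/-!
Both distances count how many data errors of some set are needed to produce a nontrivial logical
operator: the columns of the extended matrices on one side, the final data errors of single faults
on the other. A single fault of any circuit leaves, up to a stabiliser, no data error, an error on
one qubit or a residual error, so the circuit distance is at least the extended-code distance, and
the extended-code distance can only grow when residual errors are dropped.

Conversely, in a non-interleaved circuit every column is the data error of a single fault whose
flipped outcomes are the same in every round. In the memory experiment of basis `B`, if the CNOTs of
the checks of the other type come first, take data preparation errors and faults in the first round:
each round then sees the full syndrome. If they come last, take data measurement errors and faults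
in the last round: no ancilla outcome is flipped. Either way a set of such faults is undetected as
soon as its total data error commutes with the checks of type `B`.
-/

section WordDistance

variable {ι V : Type*}

/-- The least number of elements of `S`, counted with repetition, whose sum lies in `P`, or `⊤` if
no such sum exists: the distance from `0` to `P` in the Cayley graph of `S`. Circuit distances and
extended-code distances are compared through it, because both count generators of data errors. -/
noncomputable def wordDistance [AddCommMonoid V] (S P : Set V) : ℕ∞ :=
  ⨅ m ∈ {m : Multiset V | (∀ v ∈ m, v ∈ S) ∧ m.sum ∈ P}, (m.card : ℕ∞)

section AddCommMonoid

open scoped Pointwise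

variable [AddCommMonoid V] {S S' P : Set V}

lemma wordDistance_le {m : Multiset V} (hS : ∀ v ∈ m, v ∈ S) (hP : m.sum ∈ P) :
    wordDistance S P ≤ m.card :=
  iInf₂_le m ⟨hS, hP⟩

lemma wordDistance_anti_left (h : S ⊆ S') : wordDistance S' P ≤ wordDistance S P :=
  le_iInf₂ fun _ hm => wordDistance_le (fun v hv => h (hm.1 v hv)) hm.2

lemma exists_multiset_sum_add_eq {N : AddSubmonoid V} {m : Multiset V}
    (h : ∀ v ∈ m, v ∈ insert 0 S + (N : Set V)) :
    ∃ m' : Multiset V, (∀ v ∈ m', v ∈ S) ∧ m'.card ≤ m.card ∧ ∃ u ∈ N, m'.sum + u = m.sum := by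
  induction m using Multiset.induction_on with
  | empty => exact ⟨0, by simp, le_rfl, 0, N.zero_mem, by simp⟩
  | cons v m ih =>
    obtain ⟨m', hS, hcard, u, hu, hsum⟩ := ih fun w hw => h w (Multiset.mem_cons_of_mem hw)
    obtain ⟨s, hs, u', hu', rfl⟩ := Set.mem_add.1 (h v (Multiset.mem_cons_self v m))
    rcases hs with rfl | hs
    · refine ⟨m', hS, hcard.trans (by simp), u' + u, N.add_mem hu' hu, ?_⟩
      rw [Multiset.sum_cons, ← hsum, zero_add, add_left_comm]
    · refine ⟨s ::ₘ m', by simpa [hs] using hS, by simpa using hcard, u' + u,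
        N.add_mem hu' hu, ?_⟩
      rw [Multiset.sum_cons, Multiset.sum_cons, ← hsum, add_add_add_comm]

lemma wordDistance_le_of_subset_add (N : AddSubmonoid V) (hS : S' ⊆ insert 0 S + (N : Set V))
    (hP : ∀ v, ∀ u ∈ N, v + u ∈ P → v ∈ P) : wordDistance S P ≤ wordDistance S' P := by
  refine le_iInf₂ fun m ⟨hm, hmP⟩ => ?_
  obtain ⟨m', hm', hcard, u, hu, hsum⟩ := exists_multiset_sum_add_eq fun v hv => hS (hm v hv)
  exact (wordDistance_le hm' (hP _ u hu (hsum ▸ hmP))).trans (Nat.cast_le.2 hcard)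

end AddCommMonoid

section ZModTwo

variable [AddCommGroup V] [Module (ZMod 2) V]

lemma zmod_two_eq_zero_or_eq_one (a : ZMod 2) : a = 0 ∨ a = 1 := by
  revert a; decide

lemma sum_smul_eq_sum_filter_ne_zero (s : Finset ι) (x : ι → ZMod 2) (g : ι → V) :
    ∑ i ∈ s, x i • g i = ∑ i ∈ s with x i ≠ 0, g i := by
  rw [Finset.sum_filter]
  refine Finset.sum_congr rfl fun i _ => ?_
  rcases zmod_two_eq_zero_or_eq_one (x i) with h | h <;> simp [h]

lemma exists_finset_sum_eq_multiset_sum (g : ι → V) (m : Multiset ι) :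
    ∃ e : Finset ι, (∀ i ∈ e, i ∈ m) ∧ e.card ≤ m.card ∧ ∑ i ∈ e, g i = (m.map g).sum := by
  classical
  refine ⟨m.toFinset.filter fun i => (m.count i : ZMod 2) ≠ 0, fun i hi => ?_, ?_, ?_⟩
  · exact Multiset.mem_toFinset.1 (Finset.mem_filter.1 hi).1
  · exact (Finset.card_filter_le _ _).trans m.toFinset_card_le
  · rw [← sum_smul_eq_sum_filter_ne_zero, Finset.sum_multiset_map_count]
    simp only [Nat.cast_smul_eq_nsmul]

lemma wordDistance_image (g : ι → V) (A : Set ι) (P : Set V) :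
    wordDistance (g '' A) P =
      ⨅ e ∈ {e : Finset ι | (∀ i ∈ e, i ∈ A) ∧ ∑ i ∈ e, g i ∈ P}, (e.card : ℕ∞) := by
  refine le_antisymm (le_iInf₂ fun e ⟨hA, hP⟩ => ?_) (le_iInf₂ fun m ⟨hm, hP⟩ => ?_)
  · have hg : ∀ v ∈ e.val.map g, v ∈ g '' A := fun v hv => by
      obtain ⟨i, hi, rfl⟩ := Multiset.mem_map.1 hv
      exact ⟨i, hA i hi, rfl⟩
    exact (wordDistance_le hg hP).trans (by simp)
  · have : CanLift V A (fun a => g a) (· ∈ g '' A) := ⟨fun _ ⟨i, hi, hv⟩ => ⟨⟨i, hi⟩, hv⟩⟩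
    lift m to Multiset A using hm
    obtain ⟨e, he, hcard, hsum⟩ := exists_finset_sum_eq_multiset_sum g (m.map Subtype.val)
    have heA : ∀ i ∈ e, i ∈ A := fun i hi => by
      obtain ⟨a, -, rfl⟩ := Multiset.mem_map.1 (he i hi)
      exact a.2
    rw [Multiset.card_map] at hcard
    rw [Multiset.map_map] at hsum
    exact (iInf₂_le e ⟨heA, hsum ▸ hP⟩).trans (by simpa using hcard)

lemma wordDistance_range [Fintype ι] (g : ι → V) (P : Set V) :
    wordDistance (Set.range g) P =
      ⨅ x ∈ {x : ι → ZMod 2 | ∑ i, x i • g i ∈ P}, (hammingNorm x : ℕ∞) := by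
  classical
  rw [← Set.image_univ, wordDistance_image]
  simp only [sum_smul_eq_sum_filter_ne_zero]
  refine le_antisymm (le_iInf₂ fun x hx => ?_) (le_iInf₂ fun e he => ?_)
  · exact iInf₂_le (Finset.univ.filter fun i => x i ≠ 0) ⟨fun _ _ => trivial, hx⟩
  · have hsupp : (Finset.univ.filter fun i => (if i ∈ e then 1 else 0 : ZMod 2) ≠ 0) = e := by
      ext i; simp
    refine (iInf₂_le (fun i => if i ∈ e then 1 else 0) ?_).trans_eq ?_
    · simpa only [Set.mem_ofPred_eq, hsupp] using he.2
    · rw [hammingNorm, hsupp]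

end ZModTwo

end WordDistance

section DotProduct

variable {F ι κ : Type*} [Fintype ι]

lemma forall_mem_span_dotProduct_eq_zero_iff [CommSemiring F] {s : Set (ι → F)} {v : ι → F} :
    (∀ w ∈ Submodule.span F s, w ⬝ᵥ v = 0) ↔ ∀ w ∈ s, w ⬝ᵥ v = 0 := by
  classical
  simp only [dotProduct_comm _ v]
  exact Submodule.span_le (p := LinearMap.ker (dotProductEquiv F ι v))

lemma mem_span_range_row_iff [Field F] (A : Matrix κ ι F) (v : ι → F) :
    v ∈ Submodule.span F (Set.range A) ↔ ∀ w, A.mulVec w = 0 → w ⬝ᵥ v = 0 := by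
  classical
  refine ⟨fun hv w hw => ?_, fun h => ?_⟩
  · rw [dotProduct_comm]
    refine forall_mem_span_dotProduct_eq_zero_iff.2 ?_ v hv
    rintro _ ⟨i, rfl⟩
    exact congrFun hw i
  · by_contra hv
    obtain ⟨f, hf, hle⟩ := Submodule.exists_le_ker_of_notMem hv
    obtain ⟨w, rfl⟩ := (dotProductEquiv F ι).surjective f
    refine hf (h w (funext fun i => ?_))
    rw [Matrix.mulVec, dotProduct_comm]
    exact hle (Submodule.subset_span ⟨i, rfl⟩)

end DotProduct

namespace CSSCircuit

variable {n : ℕ} {K : CSSCode n}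

namespace PauliType

lemma swap_swap (b : PauliType) : b.swap.swap = b := by cases b <;> rfl

lemma swap_ne (b : PauliType) : b.swap ≠ b := by cases b <;> decide

lemma eq_or_eq_swap (a b : PauliType) : a = b ∨ a = b.swap := by
  cases a <;> cases b <;> decide

end PauliType

lemma CSSCode.H_apply (K : CSSCode n) (c : K.Check) (q : Fin n) :
    K.H c.1 c.2 q = if q ∈ K.supp c then 1 else 0 := by
  rcases zmod_two_eq_zero_or_eq_one (K.H c.1 c.2 q) with h | h <;> simp [CSSCode.supp, h]

lemma CSSCode.H_mulVec_apply (K : CSSCode n) (c : K.Check) (v : Fin n → ZMod 2) :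
    (K.H c.1).mulVec v c.2 = ∑ q ∈ K.supp c, v q := by
  simp only [Matrix.mulVec, dotProduct, K.H_apply, ite_mul, one_mul, zero_mul, Finset.sum_ite_mem,
    Finset.univ_inter]

section Logicals

/-- The nontrivial logical operators of type `b`: they commute with all checks of the other type but
are not stabilisers. -/
def CSSCode.logicals (K : CSSCode n) (b : PauliType) : Set (Fin n → ZMod 2) :=
  (K.normalizer b : Set (Fin n → ZMod 2)) \ K.stab b

variable {b : PauliType} {u v : Fin n → ZMod 2}

lemma CSSCode.mem_normalizer_swap_iff : v ∈ K.normalizer b.swap ↔ (K.H b).mulVec v = 0 := by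
  cases b <;> rfl

lemma LogicalBasis.mem_stab_iff (L : LogicalBasis K) :
    v ∈ K.stab b ↔ (K.H b.swap).mulVec v = 0 ∧ (L.L b.swap).mulVec v = 0 := by
  have hmem : v ∈ K.stab b ↔ ∀ w ∈ K.normalizer b.swap, w ⬝ᵥ v = 0 := by
    simp only [CSSCode.mem_normalizer_swap_iff]
    exact mem_span_range_row_iff (K.H b) v
  rw [hmem, ← L.span_eq, CSSCode.stab, ← Submodule.span_union,
    forall_mem_span_dotProduct_eq_zero_iff]
  simp only [Set.mem_union, or_imp, forall_and]
  exact and_congr (Set.forall_mem_range.trans funext_iff.symm)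
    (Set.forall_mem_range.trans funext_iff.symm)

lemma LogicalBasis.mem_logicals_iff (L : LogicalBasis K) :
    v ∈ K.logicals b ↔ (K.H b.swap).mulVec v = 0 ∧ (L.L b.swap).mulVec v ≠ 0 := by
  rw [CSSCode.logicals, Set.mem_sdiff, SetLike.mem_coe, SetLike.mem_coe, L.mem_stab_iff,
    not_and]
  exact and_congr_right fun h => forall_prop_of_true h

lemma LogicalBasis.add_mem_logicals_iff (L : LogicalBasis K) (hu : u ∈ K.stab b) :
    v + u ∈ K.logicals b ↔ v ∈ K.logicals b := by
  obtain ⟨hH, hL⟩ := L.mem_stab_iff.1 hu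
  rw [L.mem_logicals_iff, L.mem_logicals_iff, Matrix.mulVec_add, Matrix.mulVec_add, hH, hL,
    add_zero, add_zero]

end Logicals

section ExtendedCode

/-- The data errors indexed by the columns of the matrices extended by `R`: the single-qubit errors
and the residual errors in `R`. -/
def extColumns (R : Finset (K.Check × (Fin n → ZMod 2))) : Set (Fin n → ZMod 2) :=
  Set.range (fun q => Pi.single q 1) ∪ Prod.snd '' (R : Set (K.Check × (Fin n → ZMod 2)))

variable {R R' : Finset (K.Check × (Fin n → ZMod 2))}

lemma extColumns_mono (h : R ⊆ R') : extColumns R ⊆ extColumns R' :=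
  Set.union_subset_union_right _ (Set.image_mono (Finset.coe_subset.2 h))

lemma extend_mulVec {a : ℕ} (A : Matrix (Fin a) (Fin n) (ZMod 2))
    (R : Finset (K.Check × (Fin n → ZMod 2))) (x : Fin n ⊕ R → ZMod 2) :
    (extend A R).mulVec x =
      A.mulVec (∑ i, x i • Sum.elim (fun q => Pi.single q 1) (fun E : R => E.1.2) i) := by
  rw [Matrix.mulVec_sum, Fintype.sum_sum_type, extend, Matrix.fromCols_mulVec]
  simp only [Sum.elim_inl, Sum.elim_inr, Matrix.mulVec_smul, Matrix.mulVec_single_one]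
  congr 1
  · exact (Matrix.mulVec_eq_sum _ _).trans (by simp only [op_smul_eq_smul]; rfl)
  · exact (Matrix.mulVec_eq_sum _ _).trans (by simp only [op_smul_eq_smul]; rfl)

lemma typeExtDistance_eq_wordDistance (L : LogicalBasis K) (b : PauliType)
    (R : Finset (K.Check × (Fin n → ZMod 2))) :
    typeExtDistance L b R = wordDistance (extColumns R) (K.logicals b) := by
  have hcol : extColumns R =
      Set.range (Sum.elim (fun q => Pi.single q 1) (fun E : R => E.1.2)) := by
    rw [Set.Sum.elim_range, extColumns, Set.image_eq_range]
    rfl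
  simp only [hcol, wordDistance_range, typeExtDistance, extend_mulVec, L.mem_logicals_iff]

lemma typeExtDistance_anti (L : LogicalBasis K) (b : PauliType) (h : R ⊆ R') :
    typeExtDistance L b R' ≤ typeExtDistance L b R := by
  simpa only [typeExtDistance_eq_wordDistance] using wordDistance_anti_left (extColumns_mono h)

lemma extDistance_anti (L : LogicalBasis K) (h : R ⊆ R') :
    extDistance L R' ≤ extDistance L R :=
  min_le_min (typeExtDistance_anti L _ (Finset.filter_subset_filter _ h))
    (typeExtDistance_anti L _ (Finset.filter_subset_filter _ h))

lemma extDistance_le_typeExtDistance (L : LogicalBasis K)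
    (R : Finset (K.Check × (Fin n → ZMod 2))) (b : PauliType) :
    extDistance L R ≤ typeExtDistance L b (R.filter fun E => E.1.1 = b) := by
  cases b
  · exact min_le_left _ _
  · exact min_le_right _ _

lemma typeExtDistance_le_residualDistance (L : LogicalBasis K)
    {E : K.Check × (Fin n → ZMod 2)} (hE : E ∈ R) :
    typeExtDistance L E.1.1 R ≤ residualDistance K E := by
  rw [typeExtDistance_eq_wordDistance, residualDistance, ENat.add_iInf₂]
  refine le_iInf₂ fun D hD => ?_
  let m := E.2 ::ₘ (Finset.univ.filter fun q => D q ≠ 0).val.map fun q => Pi.single q 1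
  have hS : ∀ v ∈ m, v ∈ extColumns R := fun v hv => by
    rcases Multiset.mem_cons.1 hv with rfl | hv
    · exact Or.inr ⟨E, hE, rfl⟩
    · obtain ⟨q, -, rfl⟩ := Multiset.mem_map.1 hv
      exact Or.inl ⟨q, rfl⟩
  have hsum : m.sum = E.2 + D := by
    rw [Multiset.sum_cons, ← Finset.sum_eq_multiset_sum, ← sum_smul_eq_sum_filter_ne_zero,
      ← pi_eq_sum_univ']
  refine (wordDistance_le hS (hsum ▸ hD)).trans_eq ?_
  rw [Multiset.card_cons, Multiset.card_map, add_comm, Nat.cast_add, Nat.cast_one]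
  rfl

lemma extDistance_le_residualDistance (L : LogicalBasis K)
    {E : K.Check × (Fin n → ZMod 2)} (hE : E ∈ R) : extDistance L R ≤ residualDistance K E :=
  (extDistance_le_typeExtDistance L R E.1.1).trans
    (typeExtDistance_le_residualDistance L (Finset.mem_filter.2 ⟨hE, rfl⟩))

end ExtendedCode

section ReducedErrors

open scoped Pointwise

/-- The errors that are, up to a stabiliser of type `b`, zero or an error in `extColumns R`. The
data errors that a single fault can cause are of this form. -/
def reducedErrors (b : PauliType) (R : Finset (K.Check × (Fin n → ZMod 2))) :
    Set (Fin n → ZMod 2) :=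
  insert 0 (extColumns R) + (K.stab b : Set (Fin n → ZMod 2))

variable {b : PauliType} {R : Finset (K.Check × (Fin n → ZMod 2))} {v : Fin n → ZMod 2}

lemma mem_reducedErrors_of_mem_stab (hv : v ∈ K.stab b) : v ∈ reducedErrors b R :=
  Set.mem_add.2 ⟨0, Set.mem_insert _ _, v, hv, zero_add v⟩

lemma mem_reducedErrors_of_mem_extColumns (hv : v ∈ extColumns R) : v ∈ reducedErrors b R :=
  Set.mem_add.2 ⟨v, Set.mem_insert_of_mem _ hv, 0, zero_mem _, add_zero v⟩

lemma zero_mem_reducedErrors : 0 ∈ reducedErrors b R :=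
  mem_reducedErrors_of_mem_stab (zero_mem _)

lemma single_mem_reducedErrors (q : Fin n) (a : ZMod 2) :
    Pi.single q a ∈ reducedErrors b R := by
  rcases zmod_two_eq_zero_or_eq_one a with rfl | rfl
  · simpa using zero_mem_reducedErrors
  · exact mem_reducedErrors_of_mem_extColumns (Or.inl ⟨q, rfl⟩)

end ReducedErrors

namespace SEC

variable (C : SEC K) {M T r s t : ℕ} {b B : PauliType} {c : K.Check} {q : Fin n}

section Timing

lemma start_meas_lt_start_prep (h : r < s) (c : K.Check) :
    C.start r + C.meas c < C.start s + C.prep c := by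
  induction s, h using Nat.le_induction with
  | base => exact C.reuse r c
  | succ s _ ih =>
    have := C.reuse s c
    have := C.prep_lt_meas c
    omega

lemma start_le_start (c : K.Check) (h : r ≤ s) : C.start r ≤ C.start s := by
  rcases h.eq_or_lt with rfl | h
  · rfl
  · have := C.start_meas_lt_start_prep h c
    have := C.prep_lt_meas c
    omega

lemma round_unique (hr : C.start r + C.prep c ≤ t) (hr' : t ≤ C.start r + C.meas c)
    (hs : C.start s + C.prep c ≤ t) (hs' : t ≤ C.start s + C.meas c) : r = s := by
  rcases lt_trichotomy r s with h | h | h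
  · have := C.start_meas_lt_start_prep h c
    omega
  · exact h
  · have := C.start_meas_lt_start_prep h c
    omega

lemma start_meas_lt_duration (h : r < M) (c : K.Check) :
    C.start r + C.meas c < C.duration M :=
  Finset.le_sup (f := fun p : ℕ × K.Check => C.start p.1 + C.meas p.2 + 1)
    (b := (r, c)) (by simpa using h)

lemma start_cnot_lt_duration (h : r < M) (hq : q ∈ K.supp c) :
    C.start r + C.cnot c q < C.duration M :=
  (Nat.add_lt_add_left (C.cnot_lt_meas c q hq) _).trans (C.start_meas_lt_duration h c)

lemma cnotAt_iff_of_mem_round (hr : r < M) (hp : C.start r + C.prep c ≤ t)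
    (ht : t ≤ C.start r + C.meas c) :
    C.CNOTAt M t c q ↔ q ∈ K.supp c ∧ t = C.start r + C.cnot c q := by
  constructor
  · rintro ⟨hq, s, -, rfl⟩
    have := C.cnot_lt_meas c q hq
    have := C.prep_lt_cnot c q hq
    obtain rfl := C.round_unique hp ht (s := s) (by omega) (by omega)
    exact ⟨hq, rfl⟩
  · rintro ⟨hq, h⟩
    exact ⟨hq, r, Finset.mem_range.2 hr, h⟩

lemma not_prepAt_of_mem_round (hp : C.start r + C.prep c < t)
    (ht : t ≤ C.start r + C.meas c) : ¬ C.PrepAt M t c := by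
  rintro ⟨s, -, h⟩
  have := C.prep_lt_meas c
  obtain rfl := C.round_unique hp.le ht (s := s) (by omega) (by omega)
  omega

end Timing

section DataSpread

/-- An error on the ancilla of `c` just before time step `t` spreads to the data qubit `q` before
time step `T`. -/
def Reaches (M T t : ℕ) (c : K.Check) (q : Fin n) : Prop :=
  q ∈ K.supp c ∧ ∃ r ∈ Finset.range M, C.start r + C.prep c < t ∧
    t ≤ C.start r + C.cnot c q ∧ C.start r + C.cnot c q < T

instance (M T t : ℕ) (c : K.Check) (q : Fin n) : Decidable (C.Reaches M T t c q) := by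
  unfold Reaches; infer_instance

lemma reaches_iff_cnotAt_or (ht : t < T) : C.Reaches M T t c q ↔
    C.CNOTAt M t c q ∨ ¬ C.PrepAt M t c ∧ C.Reaches M T (t + 1) c q := by
  constructor
  · rintro ⟨hq, r, hr, hp, hle, hT⟩
    have := C.cnot_lt_meas c q hq
    rcases hle.eq_or_lt with h | h
    · exact Or.inl ⟨hq, r, hr, h⟩
    · exact Or.inr ⟨C.not_prepAt_of_mem_round hp (by omega), hq, r, hr, by omega, h, hT⟩
  · rintro (⟨hq, r, hr, rfl⟩ | ⟨hprep, hq, r, hr, hp, hle, hT⟩)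
    · exact ⟨hq, r, hr, Nat.add_lt_add_left (C.prep_lt_cnot c q hq) _, le_rfl, ht⟩
    · refine ⟨hq, r, hr, lt_of_le_of_ne (Nat.le_of_lt_succ hp) fun h => ?_, by omega, hT⟩
      exact hprep ⟨r, hr, h.symm⟩

lemma CNOTAt.not_reaches_succ {C : SEC K} (h : C.CNOTAt M t c q) :
    ¬ C.Reaches M T (t + 1) c q := by
  obtain ⟨hq, r, -, rfl⟩ := h
  rintro ⟨-, s, -, hp, hle, -⟩
  have := C.cnot_lt_meas c q hq
  have := C.prep_lt_cnot c q hq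
  obtain rfl := C.round_unique (r := r) (s := s) (c := c) (t := C.start r + C.cnot c q)
    (by omega) (by omega) (by omega) (by omega)
  omega

lemma reaches_iff_of_mem_round (hr : r < M) (hp : C.start r + C.prep c < t)
    (ht : t ≤ C.start r + C.meas c + 1) : C.Reaches M T t c q ↔
      q ∈ K.supp c ∧ t ≤ C.start r + C.cnot c q ∧ C.start r + C.cnot c q < T := by
  constructor
  · rintro ⟨hq, s, -, hs, hle, hT⟩
    have := C.cnot_lt_meas c q hq
    obtain rfl := C.round_unique (r := r) (s := s) (c := c) (t := t - 1)
      (by omega) (by omega) (by omega) (by omega)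
    exact ⟨hq, hle, hT⟩
  · rintro ⟨hq, hle, hT⟩
    exact ⟨hq, r, Finset.mem_range.2 hr, hp, hle, hT⟩

/-- The `b` component of the data error just before time step `T` into which a Pauli error just
before time step `t` evolves. -/
def dataSpread (b : PauliType) (M T t : ℕ) : Frame K →+ (Fin n → ZMod 2) where
  toFun F q := F (.inl q) b +
    ∑ c : K.Check, if c.1 = b ∧ C.Reaches M T t c q then F (.inr c) b else 0
  map_zero' := by ext q; simp
  map_add' F G := by
    ext q
    simp only [Pi.add_apply, ite_add_zero, Finset.sum_add_distrib]
    ring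

lemma dataSpread_apply (F : Frame K) (q : Fin n) : C.dataSpread b M T t F q =
    F (.inl q) b + ∑ c : K.Check, if c.1 = b ∧ C.Reaches M T t c q then F (.inr c) b else 0 :=
  rfl

lemma dataSpread_zero (F : Frame K) (q : Fin n) :
    C.dataSpread b M T 0 F q = F (.inl q) b := by
  simp [dataSpread_apply, Reaches]

lemma dataSpread_self (F : Frame K) (q : Fin n) :
    C.dataSpread b M T T F q = F (.inl q) b := by
  have hT (c : K.Check) : ¬ C.Reaches M T T c q := by
    rintro ⟨-, r, -, -, hle, hlt⟩
    omega
  simp [dataSpread_apply, hT]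

lemma dataSpread_propagate (ht : t < T) (F : Frame K) :
    C.dataSpread b M T (t + 1) (C.propagate M t F) = C.dataSpread b M T t F := by
  ext q
  simp only [dataSpread_apply, propagate, add_assoc, ← Finset.sum_add_distrib]
  congr 1
  refine Finset.sum_congr rfl fun c _ => ?_
  by_cases hb : c.1 = b
  · by_cases hcnot : C.CNOTAt M t c q
    · simp [C.reaches_iff_cnotAt_or ht, hb, hcnot, hcnot.not_reaches_succ]
    · by_cases hprep : C.PrepAt M t c <;>
        simp [C.reaches_iff_cnotAt_or ht, hb, hcnot, hprep]
  · simp [hb]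

lemma dataSpread_single_inl (q : Fin n) (P : Pauli) :
    C.dataSpread b M T t (Pi.single (.inl q) P) = Pi.single q (P b) := by
  ext q'
  rcases eq_or_ne q' q with rfl | h
  · simp [dataSpread_apply]
  · simp [dataSpread_apply, h]

lemma dataSpread_single_inr (c : K.Check) (P : Pauli) (q : Fin n) :
    C.dataSpread b M T t (Pi.single (.inr c) P) q =
      if c.1 = b ∧ C.Reaches M T t c q then P b else 0 := by
  rw [dataSpread_apply, Finset.sum_eq_single c]
  · simp
  · intro c' _ h
    simp [Pi.single_eq_of_ne (Sum.inr_injective.ne h : (Sum.inr c' : K.Qubit) ≠ Sum.inr c)]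
  · simp

lemma dataSpread_frame (b B : PauliType) (e : Finset (Fault K)) (ht : t ≤ T) :
    C.dataSpread b M T t (C.frame B M e t) = C.dataSpread b M T 0 (∑ f ∈ e, injectInit B f) +
      ∑ s ∈ Finset.range t, C.dataSpread b M T (s + 1) (∑ f ∈ e, C.inject s f) := by
  induction t with
  | zero => simp [frame]
  | succ t ih =>
    rw [frame, map_add, dataSpread_propagate C ht, ih (Nat.le_of_succ_le ht),
      Finset.sum_range_succ, add_assoc]

end DataSpread

section Tail

/-- The data error caused by an ancilla error of the type of the check `c` that is present just
before the local time `k` of a round. Residual errors are of this form, see `SEC.tail`. -/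
def tailFrom (c : K.Check) (k : ℕ) : Fin n → ZMod 2 :=
  fun q => if q ∈ K.supp c ∧ k ≤ C.cnot c q then 1 else 0

/-- The residual errors of type `b`. -/
abbrev typeResidualErrors (b : PauliType) : Finset (K.Check × (Fin n → ZMod 2)) :=
  C.residualErrors.filter fun E => E.1.1 = b

lemma tail_eq_tailFrom (c : K.Check) (q : Fin n) : C.tail c q = C.tailFrom c (C.cnot c q) := rfl

lemma tailFrom_cnot_succ_add_single (hq : q ∈ K.supp c) :
    C.tailFrom c (C.cnot c q + 1) + Pi.single q 1 = C.tail c q := by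
  ext q'
  rcases eq_or_ne q' q with rfl | hne
  · simp [tail, tailFrom, hq]
  · by_cases hq' : q' ∈ K.supp c
    · have := (C.cnot_inj c).ne hq' hq hne
      have : C.cnot c q + 1 ≤ C.cnot c q' ↔ C.cnot c q ≤ C.cnot c q' := by omega
      simp [tail, tailFrom, hne, this]
    · simp [tail, tailFrom, hne, hq']

lemma mem_typeResidualErrors_iff {E : K.Check × (Fin n → ZMod 2)} :
    E ∈ C.typeResidualErrors b ↔ E.1.1 = b ∧ ∃ q ∈ K.supp E.1,
      (∃ q' ∈ K.supp E.1, C.cnot E.1 q' < C.cnot E.1 q) ∧ C.tail E.1 q = E.2 := by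
  obtain ⟨c, v⟩ := E
  simp only [typeResidualErrors, residualErrors, Finset.mem_filter, Finset.mem_image,
    Finset.mem_univ, true_and, Prod.exists, Prod.mk.injEq]
  constructor
  · rintro ⟨⟨c', q, ⟨hq, hlt⟩, rfl, htail⟩, hb⟩
    exact ⟨hb, q, hq, hlt, htail⟩
  · rintro ⟨hb, q, hq, hlt, htail⟩
    exact ⟨⟨c, q, ⟨hq, hlt⟩, rfl, htail⟩, hb⟩

lemma tailFrom_mem_reducedErrors (c : K.Check) (k : ℕ) :
    C.tailFrom c k ∈ reducedErrors c.1 (C.typeResidualErrors c.1) := by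
  by_cases hall : ∀ q ∈ K.supp c, k ≤ C.cnot c q
  · have hrow : C.tailFrom c k = K.H c.1 c.2 := by
      ext q
      rw [K.H_apply]
      exact if_congr (and_iff_left_of_imp (hall q)) rfl rfl
    exact mem_reducedErrors_of_mem_stab (Submodule.subset_span ⟨c.2, hrow.symm⟩)
  obtain ⟨q', hq', hlt⟩ : ∃ q' ∈ K.supp c, C.cnot c q' < k := by push Not at hall; exact hall
  rcases ((K.supp c).filter fun q => k ≤ C.cnot c q).eq_empty_or_nonempty with hnone | hsome
  · have hzero : C.tailFrom c k = 0 :=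
      funext fun q => if_neg fun h => Finset.eq_empty_iff_forall_notMem.1 hnone q (by simpa)
    exact hzero ▸ zero_mem_reducedErrors
  · obtain ⟨q, hq, hmin⟩ := Finset.exists_min_image _ (C.cnot c) hsome
    rw [Finset.mem_filter] at hq
    have htail : C.tail c q = C.tailFrom c k := by
      ext p
      refine if_congr (and_congr_right fun hp => ⟨fun h => hq.2.trans h, fun h => ?_⟩) rfl rfl
      exact hmin p (Finset.mem_filter.2 ⟨hp, h⟩)
    have hE : (c, C.tailFrom c k) ∈ C.typeResidualErrors c.1 :=
      (C.mem_typeResidualErrors_iff).2 ⟨rfl, q, hq.1, ⟨q', hq', hlt.trans_le hq.2⟩, htail⟩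
    exact mem_reducedErrors_of_mem_extColumns (Or.inr ⟨_, hE, rfl⟩)

lemma dataSpread_single_inr_of_mem_round {k : ℕ} (hr : r < M) (hp : C.prep c < k)
    (hk : k ≤ C.meas c + 1) (P : Pauli) (q : Fin n) :
    C.dataSpread c.1 M T (C.start r + k) (Pi.single (.inr c) P) q =
      if C.start r + C.cnot c q < T then P c.1 * C.tailFrom c k q else 0 := by
  have hreach := C.reaches_iff_of_mem_round (T := T) (q := q) hr
    (Nat.add_lt_add_left hp _) (Nat.add_le_add_left hk _)
  simp only [dataSpread_single_inr, hreach, add_le_add_iff_left, true_and, tailFrom, mul_ite,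
    mul_one, mul_zero, ← ite_and]
  exact if_congr (by tauto) rfl rfl

lemma dataSpread_single_inr_mem_reducedErrors (b : PauliType) (t : ℕ) (c : K.Check) (P : Pauli) :
    C.dataSpread b M (C.duration M) t (Pi.single (.inr c) P) ∈
      reducedErrors b (C.typeResidualErrors b) := by
  by_cases hmem : c.1 = b ∧ P c.1 = 1 ∧
      ∃ r < M, C.start r + C.prep c < t ∧ t ≤ C.start r + C.meas c + 1
  · obtain ⟨rfl, hP, r, hr, hp, hm⟩ := hmem
    obtain ⟨k, rfl⟩ : ∃ k, t = C.start r + k := ⟨t - C.start r, by omega⟩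
    convert C.tailFrom_mem_reducedErrors c k
    ext q
    rw [C.dataSpread_single_inr_of_mem_round hr (by omega) (by omega), hP, one_mul,
      ite_eq_left_iff]
    exact fun hT => (if_neg fun h => hT (C.start_cnot_lt_duration hr h.1)).symm
  · convert zero_mem_reducedErrors
    ext q
    rw [dataSpread_single_inr, Pi.zero_apply, ite_eq_right_iff]
    rintro ⟨rfl, hq, r, hr, hp, hle, -⟩
    have := C.cnot_lt_meas c q hq
    exact (zmod_two_eq_zero_or_eq_one _).resolve_right fun hP =>
      hmem ⟨rfl, hP, r, Finset.mem_range.1 hr, hp, by omega⟩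

end Tail

section Superposition

/-- The action of the operations of one time step on Pauli errors, as a group homomorphism. -/
def propagateHom (M t : ℕ) : Frame K →+ Frame K :=
  AddMonoidHom.mk' (C.propagate M t) fun F G => by
    ext v b
    cases v with
    | inl q =>
      simp only [propagate, Pi.add_apply, ite_add_zero, Finset.sum_add_distrib]
      ring
    | inr c =>
      by_cases hprep : C.PrepAt M t c
      · simp [propagate, hprep]
      · simp only [propagate, hprep, if_false, Pi.add_apply, ite_add_zero,
          Finset.sum_add_distrib]
        ring

lemma frame_eq_sum_singleton (B : PauliType) (M : ℕ) (e : Finset (Fault K)) (t : ℕ) :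
    C.frame B M e t = ∑ f ∈ e, C.frame B M {f} t := by
  induction t with
  | zero => simp [frame]
  | succ t ih =>
    change C.propagateHom M t (C.frame B M e t) + _ =
      ∑ f ∈ e, (C.propagateHom M t (C.frame B M {f} t) + _)
    simp only [Finset.sum_add_distrib, ih, map_sum, Finset.sum_singleton]

lemma ancFlip_eq_sum_singleton (B : PauliType) (M : ℕ) (e : Finset (Fault K)) (r : ℕ)
    (c : K.Check) : C.ancFlip B M e r c = ∑ f ∈ e, C.ancFlip B M {f} r c := by
  simp only [ancFlip, C.frame_eq_sum_singleton B M e, Finset.sum_apply, Finset.sum_singleton,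
    Finset.sum_add_distrib]

lemma dataFlip_eq_sum_singleton (B : PauliType) (M : ℕ) (e : Finset (Fault K)) :
    C.dataFlip B M e = ∑ f ∈ e, C.dataFlip B M {f} := by
  ext q
  simp only [dataFlip, C.frame_eq_sum_singleton B M e, Finset.sum_apply, Finset.sum_singleton,
    Finset.sum_add_distrib]

end Superposition

section SingleFault

variable {f : Fault K}

lemma frame_singleton_inl_of_inject_eq_zero (h : ∀ t, C.inject t f = 0) (q : Fin n) :
    C.frame B M {f} T (.inl q) b = injectInit B f (.inl q) b := by
  rw [← C.dataSpread_self (M := M) (T := T) (C.frame B M {f} T),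
    C.dataSpread_frame b B {f} le_rfl]
  simp [h, dataSpread_zero]

lemma frame_singleton_inl_of_inject_eq_ite {F : Frame K} (hinit : injectInit B f = 0)
    (h : ∀ t, C.inject t f = if t = s then F else 0) (q : Fin n) :
    C.frame B M {f} T (.inl q) b = if s < T then C.dataSpread b M T (s + 1) F q else 0 := by
  have hsum : ∑ t ∈ Finset.range T, C.dataSpread b M T (t + 1) (if t = s then F else 0) =
      if s < T then C.dataSpread b M T (s + 1) F else 0 := by
    simp only [apply_ite (C.dataSpread b M T _), map_zero, Finset.sum_ite_eq',
      Finset.mem_range]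
  rw [← C.dataSpread_self (M := M) (T := T) (C.frame B M {f} T),
    C.dataSpread_frame b B {f} le_rfl]
  simp only [Finset.sum_singleton, hinit, map_zero, zero_add, h, hsum]
  split_ifs <;> rfl

lemma dataFlip_singleton_of_inject_eq_ite {F : Frame K} (hinit : injectInit B f = 0)
    (h : ∀ t, C.inject t f = if t = s then F else 0) (hs : s < C.duration M)
    (hread : ∀ q, dataReadout q f = 0) :
    C.dataFlip B M {f} = C.dataSpread B.swap M (C.duration M) (s + 1) F := by
  ext q
  rw [dataFlip, C.frame_singleton_inl_of_inject_eq_ite hinit h, if_pos hs, Finset.sum_singleton,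
    hread, add_zero]

lemma dataFlip_prepData (q : Fin n) : C.dataFlip B M {.prepData q} = Pi.single q 1 := by
  ext q'
  rw [dataFlip, C.frame_singleton_inl_of_inject_eq_zero fun _ => rfl]
  rcases eq_or_ne q' q with rfl | h
  · simp [injectInit, dataReadout]
  · simp [injectInit, dataReadout, h]

lemma dataFlip_measData (q : Fin n) : C.dataFlip B M {.measData q} = Pi.single q 1 := by
  ext q'
  rw [dataFlip, C.frame_singleton_inl_of_inject_eq_zero fun _ => rfl]
  simp [injectInit, dataReadout, Pi.single_apply, eq_comm]

lemma dataFlip_measAnc (r : ℕ) (c : K.Check) : C.dataFlip B M {.measAnc r c} = 0 := by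
  ext q
  rw [dataFlip, C.frame_singleton_inl_of_inject_eq_zero fun _ => rfl]
  simp [injectInit, dataReadout]

lemma dataSpread_single_add_single_mem_reducedErrors (hr : r < M) (hq : q ∈ K.supp c)
    (b : PauliType) (P Q : Pauli) :
    C.dataSpread b M (C.duration M) (C.start r + C.cnot c q + 1)
      (Pi.single (.inr c) P + Pi.single (.inl q) Q) ∈
        reducedErrors b (C.typeResidualErrors b) := by
  rw [map_add, dataSpread_single_inl]
  rcases zmod_two_eq_zero_or_eq_one (Q b) with hQ | hQ
  · rw [hQ, Pi.single_zero, add_zero]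
    exact C.dataSpread_single_inr_mem_reducedErrors _ _ _ _
  by_cases h : c.1 = b ∧ P b = 1
  · obtain ⟨rfl, hP⟩ := h
    convert C.tailFrom_mem_reducedErrors c (C.cnot c q)
    rw [← tail_eq_tailFrom, ← C.tailFrom_cnot_succ_add_single hq, hQ]
    congr 1
    ext q'
    have := C.prep_lt_cnot c q hq
    have := C.cnot_lt_meas c q hq
    rw [add_assoc, C.dataSpread_single_inr_of_mem_round hr (by omega) (by omega), hP, one_mul,
      ite_eq_left_iff]
    exact fun hT => (if_neg fun h => hT (C.start_cnot_lt_duration hr h.1)).symm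
  · convert single_mem_reducedErrors q (Q b)
    rw [add_eq_right]
    ext q'
    rw [dataSpread_single_inr, Pi.zero_apply, ite_eq_right_iff]
    exact fun hc => (zmod_two_eq_zero_or_eq_one _).resolve_right fun hP => h ⟨hc.1, hP⟩

lemma IsFault.dataFlip_mem_reducedErrors {C : SEC K} (hf : C.IsFault M f) (B : PauliType) :
    C.dataFlip B M {f} ∈ reducedErrors B.swap (C.typeResidualErrors B.swap) := by
  cases f with
  | prepData q => exact C.dataFlip_prepData q ▸ single_mem_reducedErrors q 1
  | measData q => exact C.dataFlip_measData q ▸ single_mem_reducedErrors q 1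
  | measAnc r c => exact C.dataFlip_measAnc r c ▸ zero_mem_reducedErrors
  | prepAnc r c =>
    have hs : C.start r + C.prep c < C.duration M :=
      (Nat.add_lt_add_left (C.prep_lt_meas c) _).trans (C.start_meas_lt_duration hf c)
    rw [C.dataFlip_singleton_of_inject_eq_ite rfl (fun _ => rfl) hs fun _ => rfl]
    exact C.dataSpread_single_inr_mem_reducedErrors _ _ _ _
  | cnot r c q P Q =>
    obtain ⟨hr, hq, -⟩ := hf
    rw [C.dataFlip_singleton_of_inject_eq_ite rfl (fun _ => rfl)
      (C.start_cnot_lt_duration hr hq) fun _ => rfl]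
    exact C.dataSpread_single_add_single_mem_reducedErrors hr hq _ _ _
  | idle t v P =>
    rw [C.dataFlip_singleton_of_inject_eq_ite rfl (fun _ => rfl) hf.1 fun _ => rfl]
    cases v with
    | inl q => exact C.dataSpread_single_inl q P ▸ single_mem_reducedErrors q _
    | inr c => exact C.dataSpread_single_inr_mem_reducedErrors _ _ _ _

end SingleFault

section LowerBound

lemma Undetected.mulVec_dataFlip {C : SEC K} {e : Finset (Fault K)} (h : C.Undetected B M e) :
    (K.H B).mulVec (C.dataFlip B M e) = 0 := by
  obtain ⟨hconsecutive, hfirst, hlast⟩ := h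
  ext i
  have hanc : ∀ r ≤ M - 1, C.ancFlip B M e r ⟨B, i⟩ = 0 := by
    intro r
    induction r with
    | zero => exact fun _ => hfirst i
    | succ r ih =>
      intro hr
      have := hconsecutive ⟨B, i⟩ r (by omega)
      rwa [ih (by omega), zero_add] at this
  have := hlast i
  rwa [hanc _ le_rfl, zero_add] at this

lemma typeExtDistance_le_memoryDistance (L : LogicalBasis K) (B : PauliType) (M : ℕ) :
    typeExtDistance L B.swap (C.typeResidualErrors B.swap) ≤ C.memoryDistance L B M := by
  let faults : Set (Fault K) := {f | C.IsFault M f}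
  calc typeExtDistance L B.swap (C.typeResidualErrors B.swap)
    _ = wordDistance (extColumns (C.typeResidualErrors B.swap)) (K.logicals B.swap) :=
      typeExtDistance_eq_wordDistance L _ _
    _ ≤ wordDistance ((fun f => C.dataFlip B M {f}) '' faults) (K.logicals B.swap) := by
      refine wordDistance_le_of_subset_add (K.stab B.swap).toAddSubmonoid ?_
        fun v u hu => (L.add_mem_logicals_iff hu).1
      rintro _ ⟨f, hf, rfl⟩
      exact IsFault.dataFlip_mem_reducedErrors hf B
    _ ≤ C.memoryDistance L B M := by
      rw [wordDistance_image]
      refine le_iInf₂ fun e ⟨hfault, hundet, hlog⟩ => iInf₂_le e ⟨hfault, ?_⟩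
      rw [← dataFlip_eq_sum_singleton, L.mem_logicals_iff, PauliType.swap_swap]
      exact ⟨hundet.mulVec_dataFlip, hlog⟩

lemma extDistance_le_circuitDistance (L : LogicalBasis K) (M : ℕ) :
    extDistance L C.residualErrors ≤ C.circuitDistance L M := by
  rw [extDistance, circuitDistance, min_comm]
  exact min_le_min (C.typeExtDistance_le_memoryDistance L .X M)
    (C.typeExtDistance_le_memoryDistance L .Z M)

end LowerBound

section UpperBound

variable {f : Fault K} {ε : ZMod 2}

/-- In every round, the flipped outcomes are the syndrome of the final data error of `f` if `ε = 1`,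
and none if `ε = 0`. -/
def HasConstantSyndrome (B : PauliType) (M : ℕ) (ε : ZMod 2) (f : Fault K) : Prop :=
  ∀ r < M, ∀ c : K.Check, C.ancFlip B M {f} r c =
    if c.1 = B then ε * ∑ q ∈ K.supp c, C.dataFlip B M {f} q else 0

lemma undetected_of_forall_hasConstantSyndrome {e : Finset (Fault K)} (hM : 1 ≤ M)
    (he : ∀ f ∈ e, C.HasConstantSyndrome B M ε f)
    (hH : (K.H B).mulVec (C.dataFlip B M e) = 0) : C.Undetected B M e := by
  have hanc : ∀ r < M, ∀ c, C.ancFlip B M e r c = 0 := by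
    intro r hr c
    rw [ancFlip_eq_sum_singleton, Finset.sum_congr rfl fun f hf => he f hf r hr c]
    split_ifs with hc
    · subst hc
      have hsyn := congrFun hH c.2
      simp only [K.H_mulVec_apply c, C.dataFlip_eq_sum_singleton _ M e, Finset.sum_apply] at hsyn
      rw [← Finset.mul_sum, Finset.sum_comm, hsyn, Pi.zero_apply, mul_zero]
    · exact Finset.sum_const_zero
  refine ⟨fun c r hr => ?_, fun i => hanc 0 hM _, fun i => ?_⟩
  · rw [hanc r (by omega), hanc (r + 1) hr, add_zero]
  · rw [hanc (M - 1) (by omega), hH, Pi.zero_apply, add_zero]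

lemma memoryDistance_le_typeExtDistance_of_forall_exists (L : LogicalBasis K) (hM : 1 ≤ M)
    {R : Finset (K.Check × (Fin n → ZMod 2))}
    (hR : ∀ v ∈ extColumns R, ∃ f, C.IsFault M f ∧ C.HasConstantSyndrome B M ε f ∧
      C.dataFlip B M {f} = v) :
    C.memoryDistance L B M ≤ typeExtDistance L B.swap R := by
  let faults : Set (Fault K) := {f | C.IsFault M f ∧ C.HasConstantSyndrome B M ε f}
  have hcol : extColumns R ⊆ (fun f => C.dataFlip B M {f}) '' faults := fun v hv =>
    let ⟨f, hfault, hsyn, hflip⟩ := hR v hv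
    ⟨f, ⟨hfault, hsyn⟩, hflip⟩
  rw [typeExtDistance_eq_wordDistance]
  refine le_trans ?_ (wordDistance_anti_left hcol)
  rw [wordDistance_image]
  refine le_iInf₂ fun e ⟨he, hlog⟩ => iInf₂_le e ?_
  rw [← dataFlip_eq_sum_singleton, L.mem_logicals_iff, PauliType.swap_swap] at hlog
  exact ⟨fun f hf => (he f hf).1,
    C.undetected_of_forall_hasConstantSyndrome hM (fun f hf => (he f hf).2) hlog.1, hlog.2⟩

lemma frame_singleton_component_eq_zero (hinit : ∀ v, injectInit B f v b = 0)
    (hinj : ∀ t v, C.inject t f v b = 0) (t : ℕ) (v : K.Qubit) :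
    C.frame B M {f} t v b = 0 := by
  induction t generalizing v with
  | zero => simp [frame, hinit]
  | succ t ih =>
    rw [frame, Pi.add_apply, Pi.add_apply, Finset.sum_singleton, hinj, add_zero]
    cases v with
    | inl q => simp [propagate, ih]
    | inr c =>
      rw [propagate]
      split_ifs <;> simp [ih]

lemma frame_singleton_inr_prep_succ (hr : r < M)
    (hinj : ∀ t, C.inject t f (.inr c) b = 0) :
    C.frame B M {f} (C.start r + C.prep c + 1) (.inr c) b = 0 := by
  rw [frame, Pi.add_apply, Pi.add_apply, Finset.sum_singleton, hinj, add_zero, propagate,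
    if_pos ⟨r, Finset.mem_range.2 hr, rfl⟩, Pi.zero_apply]

lemma frame_singleton_inr_succ (hr : r < M) (hb : c.1 ≠ b)
    (hinj : ∀ t, C.inject t f (.inr c) b = 0) (hp : C.start r + C.prep c < t)
    (ht : t ≤ C.start r + C.meas c) :
    C.frame B M {f} (t + 1) (.inr c) b = C.frame B M {f} t (.inr c) b +
      ∑ q ∈ K.supp c with C.start r + C.cnot c q = t,
        C.frame B M {f} (C.start r + C.cnot c q) (.inl q) b := by
  rw [frame, Pi.add_apply, Pi.add_apply, Finset.sum_singleton, hinj, add_zero, propagate,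
    if_neg (C.not_prepAt_of_mem_round hp ht), ← Finset.sum_filter]
  congr 1
  refine Finset.sum_congr ?_ fun q hq => ?_
  · ext q
    simp [C.cnotAt_iff_of_mem_round hr hp.le ht, hb, eq_comm]
  · rw [(Finset.mem_filter.1 hq).2]

lemma frame_singleton_inr_meas (hr : r < M) (hb : c.1 ≠ b)
    (hinj : ∀ t, C.inject t f (.inr c) b = 0) :
    C.frame B M {f} (C.start r + C.meas c) (.inr c) b =
      ∑ q ∈ K.supp c, C.frame B M {f} (C.start r + C.cnot c q) (.inl q) b := by
  have hpartial : ∀ t, C.start r + C.prep c + 1 ≤ t → t ≤ C.start r + C.meas c →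
      C.frame B M {f} t (.inr c) b = ∑ q ∈ K.supp c with C.start r + C.cnot c q < t,
        C.frame B M {f} (C.start r + C.cnot c q) (.inl q) b := by
    intro t ht
    induction t, ht using Nat.le_induction with
    | base =>
      intro _
      rw [C.frame_singleton_inr_prep_succ hr hinj, Finset.filter_false_of_mem, Finset.sum_empty]
      intro q hq
      have := C.prep_lt_cnot c q hq
      omega
    | succ t ht ih =>
      intro hm
      rw [C.frame_singleton_inr_succ hr hb hinj ht (by omega), ih (by omega),
        ← Finset.sum_union (Finset.disjoint_filter.2 fun q _ hlt heq => hlt.ne heq),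
        ← Finset.filter_or]
      simp only [← le_iff_lt_or_eq, Nat.lt_succ_iff]
  rw [hpartial _ (Nat.add_lt_add_left (C.prep_lt_meas c) _) le_rfl, Finset.filter_true_of_mem]
  exact fun q hq => Nat.add_lt_add_left (C.cnot_lt_meas c q hq) _

lemma hasConstantSyndrome_of_frame_inl (hinit : ∀ v, injectInit B f v B = 0)
    (hinj : ∀ t v, C.inject t f v B = 0)
    (hanc : ∀ t (c : K.Check), c.1 = B → C.inject t f (.inr c) B.swap = 0)
    (hread : ∀ r c, ancReadout r c f = 0)
    (hdata : ∀ r < M, ∀ c : K.Check, c.1 = B → ∀ q ∈ K.supp c,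
      C.frame B M {f} (C.start r + C.cnot c q) (.inl q) B.swap = ε * C.dataFlip B M {f} q) :
    C.HasConstantSyndrome B M ε f := by
  intro r hr c
  rw [ancFlip, Finset.sum_singleton, hread, add_zero]
  rcases PauliType.eq_or_eq_swap c.1 B with hc | hc
  · rw [hc, if_pos rfl, C.frame_singleton_inr_meas hr (hc.trans_ne (PauliType.swap_ne B).symm)
      fun t => hanc t c hc, Finset.sum_congr rfl (hdata r hr c hc), Finset.mul_sum]
  · rw [hc, PauliType.swap_swap, if_neg (PauliType.swap_ne B),
      C.frame_singleton_component_eq_zero hinit hinj]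

lemma hasConstantSyndrome_prepData (q : Fin n) :
    C.HasConstantSyndrome B M 1 (.prepData q) := by
  refine C.hasConstantSyndrome_of_frame_inl (fun v => ?_) (fun _ _ => rfl) (fun _ _ _ => rfl)
    (fun _ _ => rfl) fun r _ c _ q' _ => ?_
  · rcases eq_or_ne v (.inl q) with rfl | hv
    · simp [injectInit, (PauliType.swap_ne B).symm]
    · simp [injectInit, hv]
  · rw [C.frame_singleton_inl_of_inject_eq_zero fun _ => rfl, dataFlip_prepData, one_mul]
    rcases eq_or_ne q' q with rfl | h
    · simp [injectInit]
    · simp [injectInit, h]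

lemma hasConstantSyndrome_measData (q : Fin n) :
    C.HasConstantSyndrome B M 0 (.measData q) := by
  refine C.hasConstantSyndrome_of_frame_inl (fun _ => rfl) (fun _ _ => rfl) (fun _ _ _ => rfl)
    (fun _ _ => rfl) fun r _ c _ q' _ => ?_
  rw [C.frame_singleton_inl_of_inject_eq_zero fun _ => rfl, zero_mul]
  rfl

end UpperBound

section HookFault

/-- The fault of the CNOT between the ancilla of `c` and `q` in round `r` whose data error is the
residual error `tail c q`. -/
def hookFault (r : ℕ) (c : K.Check) (q : Fin n) : Fault K :=
  .cnot r c q (Pi.single c.1 1) (Pi.single c.1 1)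

lemma isFault_hookFault (hr : r < M) (hq : q ∈ K.supp c) : C.IsFault M (hookFault r c q) :=
  ⟨hr, hq, fun h => by simpa using congrFun (congrArg Prod.fst h) c.1⟩

lemma inject_hookFault_of_ne (hb : c.1 ≠ b) (v : K.Qubit) :
    C.inject t (hookFault r c q) v b = 0 := by
  rw [hookFault, inject]
  split_ifs
  · rw [Pi.add_apply, Pi.add_apply, Pi.single_apply, Pi.single_apply]
    split_ifs <;> simp [hb.symm]
  · rfl

lemma inject_hookFault_inr_of_ne {c' : K.Check} (hc : c' ≠ c) :
    C.inject t (hookFault r c q) (.inr c') = 0 := by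
  rw [hookFault, inject]
  split_ifs
  · simp [Pi.single_eq_of_ne (Sum.inr_injective.ne hc : (Sum.inr c' : K.Qubit) ≠ Sum.inr c)]
  · rfl

lemma frame_hookFault_inl (hr : r < M) (hq : q ∈ K.supp c) (q' : Fin n) :
    C.frame B M {hookFault r c q} T (.inl q') c.1 =
      if C.start r + C.cnot c q' < T then C.tail c q q' else 0 := by
  have := C.prep_lt_cnot c q hq
  have := C.cnot_lt_meas c q hq
  rw [C.frame_singleton_inl_of_inject_eq_ite rfl (fun _ => rfl), map_add, Pi.add_apply,
    dataSpread_single_inl, add_assoc,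
    C.dataSpread_single_inr_of_mem_round hr (by omega) (by omega), Pi.single_eq_same, one_mul,
    ← C.tailFrom_cnot_succ_add_single hq, Pi.add_apply]
  rcases eq_or_ne q' q with rfl | hne
  · simp [tailFrom]
  · have htail : ¬ C.start r + C.cnot c q < T → C.start r + C.cnot c q' < T →
        C.tailFrom c (C.cnot c q + 1) q' = 0 := fun h h' => if_neg fun h'' => by omega
    simp only [Pi.single_eq_of_ne hne, add_zero]
    split_ifs with h h' h'
    · rfl
    · rfl
    · exact (htail h h').symm
    · rfl

lemma dataFlip_hookFault (hr : r < M) (hq : q ∈ K.supp c) (hB : c.1 = B.swap) :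
    C.dataFlip B M {hookFault r c q} = C.tail c q := by
  ext q'
  rw [dataFlip, ← hB, C.frame_hookFault_inl hr hq, Finset.sum_singleton,
    show dataReadout q' (hookFault r c q) = 0 from rfl, add_zero, ite_eq_left_iff]
  exact fun hT => (if_neg fun h => hT (C.start_cnot_lt_duration hr h.1)).symm

/-- In each round, the CNOTs of the checks of type `b` precede those of the checks of type `b'` on
the same data qubit. -/
def Precedes (b b' : PauliType) : Prop :=
  ∀ c c' : K.Check, c.1 = b → c'.1 = b' → ∀ q ∈ K.supp c, q ∈ K.supp c' →
    C.cnot c q < C.cnot c' q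

lemma NonInterleaved.precedes_or_precedes {C : SEC K} (h : C.NonInterleaved) (b : PauliType) :
    C.Precedes b b.swap ∨ C.Precedes b.swap b := by
  obtain ⟨a, h⟩ := h
  have ha : C.Precedes a a.swap := by
    rintro ⟨_, i⟩ ⟨_, j⟩ rfl rfl q hq hq'
    exact h i j q (Finset.mem_inter.2 ⟨hq, hq'⟩)
  rcases PauliType.eq_or_eq_swap a b with rfl | rfl
  · exact Or.inl ha
  · exact Or.inr (by rwa [PauliType.swap_swap] at ha)

lemma hasConstantSyndrome_hookFault {ε : ZMod 2} (hr : r < M) (hq : q ∈ K.supp c)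
    (hB : c.1 = B.swap)
    (horder : ∀ s < M, ∀ c' : K.Check, c'.1 = B → ∀ q' ∈ K.supp c, q' ∈ K.supp c' →
      (if C.start r + C.cnot c q' < C.start s + C.cnot c' q' then 1 else 0) = ε) :
    C.HasConstantSyndrome B M ε (hookFault r c q) := by
  have hne : c.1 ≠ B := hB.trans_ne (PauliType.swap_ne B)
  refine C.hasConstantSyndrome_of_frame_inl (fun _ => rfl)
    (fun t v => C.inject_hookFault_of_ne hne v) (fun t c' hc' => ?_) (fun _ _ => rfl)
    fun s hs c' hc' q' hq' => ?_
  · have hcc' : c' ≠ c := by rintro rfl; exact hne hc'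
    rw [C.inject_hookFault_inr_of_ne hcc', Pi.zero_apply]
  · rw [C.dataFlip_hookFault hr hq hB, ← hB, C.frame_hookFault_inl hr hq]
    by_cases hsupp : q' ∈ K.supp c
    · rw [← horder s hs c' hc' q' hsupp hq', ite_mul, one_mul, zero_mul]
    · simp [tail, hsupp]

end HookFault

section CircuitDistance

lemma exists_fault_of_mem_typeResidualErrors {ε : ZMod 2} (hr : r < M)
    (horder : ∀ c c' : K.Check, c.1 = B.swap → c'.1 = B → ∀ q ∈ K.supp c, q ∈ K.supp c' →
      ∀ s < M, (if C.start r + C.cnot c q < C.start s + C.cnot c' q then 1 else 0) = ε)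
    {E : K.Check × (Fin n → ZMod 2)} (hE : E ∈ C.typeResidualErrors B.swap) :
    ∃ f, C.IsFault M f ∧ C.HasConstantSyndrome B M ε f ∧ C.dataFlip B M {f} = E.2 := by
  obtain ⟨hB, q, hq, -, htail⟩ := C.mem_typeResidualErrors_iff.1 hE
  exact ⟨hookFault r E.1 q, C.isFault_hookFault hr hq,
    C.hasConstantSyndrome_hookFault hr hq hB fun s hs c' hc' q' hq' hq'' =>
      horder E.1 c' hB hc' q' hq' hq'' s hs,
    (C.dataFlip_hookFault hr hq hB).trans htail⟩

lemma memoryDistance_le_typeExtDistance {C : SEC K} (hC : C.NonInterleaved) (L : LogicalBasis K)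
    (B : PauliType) (hM : 1 ≤ M) :
    C.memoryDistance L B M ≤ typeExtDistance L B.swap (C.typeResidualErrors B.swap) := by
  rcases hC.precedes_or_precedes B with hlt | hlt
  · refine C.memoryDistance_le_typeExtDistance_of_forall_exists L hM (ε := 0) ?_
    rintro _ (⟨q, rfl⟩ | ⟨E, hE, rfl⟩)
    · exact ⟨.measData q, trivial, C.hasConstantSyndrome_measData q, C.dataFlip_measData q⟩
    · refine C.exists_fault_of_mem_typeResidualErrors (r := M - 1) (by omega) ?_ hE
      intro c c' hc hc' q hq hq' s hs
      have := hlt c' c hc' hc q hq' hq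
      have := C.start_le_start c (Nat.le_sub_one_of_lt hs)
      exact if_neg (by omega)
  · refine C.memoryDistance_le_typeExtDistance_of_forall_exists L hM (ε := 1) ?_
    rintro _ (⟨q, rfl⟩ | ⟨E, hE, rfl⟩)
    · exact ⟨.prepData q, trivial, C.hasConstantSyndrome_prepData q, C.dataFlip_prepData q⟩
    · refine C.exists_fault_of_mem_typeResidualErrors (r := 0) hM ?_ hE
      intro c c' hc hc' q hq hq' s _
      have := hlt c c' hc hc' q hq hq'
      have := C.start_le_start c (Nat.zero_le s)
      exact if_pos (by omega)

lemma circuitDistance_eq_extDistance {C : SEC K} (hC : C.NonInterleaved) (L : LogicalBasis K)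
    (hM : 1 ≤ M) : C.circuitDistance L M = extDistance L C.residualErrors := by
  refine le_antisymm ?_ (C.extDistance_le_circuitDistance L M)
  rw [extDistance, circuitDistance, min_comm]
  exact min_le_min (memoryDistance_le_typeExtDistance hC L .Z hM)
    (memoryDistance_le_typeExtDistance hC L .X hM)

lemma SameOrder.tail_eq {C C' : SEC K} (h : C.SameOrder C') (hq : q ∈ K.supp c) :
    C'.tail c q = C.tail c q := by
  ext q'
  refine if_congr (and_congr_right fun hq' => ?_) rfl rfl
  rw [← not_lt, ← not_lt, h c q' hq' q hq]

lemma SameOrder.residualErrors_eq {C C' : SEC K} (h : C.SameOrder C') :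
    C'.residualErrors = C.residualErrors := by
  rw [residualErrors, residualErrors]
  have hlater (p : K.Check × Fin n) :
      (p.2 ∈ K.supp p.1 ∧ ∃ q ∈ K.supp p.1, C'.cnot p.1 q < C'.cnot p.1 p.2) ↔
        p.2 ∈ K.supp p.1 ∧ ∃ q ∈ K.supp p.1, C.cnot p.1 q < C.cnot p.1 p.2 :=
    and_congr_right fun hp => exists_congr fun q => and_congr_right fun hq =>
      (h p.1 q hq p.2 hp).symm
  simp only [hlater]
  exact Finset.image_congr fun p hp => Prod.ext rfl (h.tail_eq (Finset.mem_filter.1 hp).2.1)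

end CircuitDistance

end SEC

end CSSCircuit

theorem theorem1 {n : ℕ} (K : CSSCircuit.CSSCode n) (L : CSSCircuit.LogicalBasis K)
    (C C' : CSSCircuit.SEC K) (hC' : C'.NonInterleaved) (hord : C.SameOrder C')
    (M M' : ℕ) (hM : 1 ≤ M) (hM' : 1 ≤ M') :
    C'.residualErrors = C.residualErrors ∧
    (∀ E ∈ C.residualErrors, C'.circuitDistance L M' ≤ CSSCircuit.residualDistance K E) ∧
    (∀ R ⊆ C.residualErrors, C'.circuitDistance L M' ≤ CSSCircuit.extDistance L R) ∧
    C'.circuitDistance L M' = CSSCircuit.extDistance L C.residualErrors ∧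
    C'.circuitDistance L M' ≤ C.circuitDistance L M := by
  have hR := hord.residualErrors_eq
  have hd := CSSCircuit.SEC.circuitDistance_eq_extDistance hC' L hM'
  rw [hR] at hd
  refine ⟨hR, fun E hE => ?_, fun R hRs => ?_, hd, ?_⟩ <;> rw [hd]
  · exact CSSCircuit.extDistance_le_residualDistance L hE
  · exact CSSCircuit.extDistance_anti L hRs
  · exact C.extDistance_le_circuitDistance L M
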